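/- Let $\Omega\subset\mathbb R^2$ be a bounded strictly convex domain with smooth boundary, let $d$ be its inradius (the radius of the largest ball contained in $\Omega$), and let $\alpha>1$. Suppose $d<\pi/2$, and let $u\in C^2(\Omega)\cap C^0(\overline\Omega)$ be a classical solution of $$\operatorname{div}\left(\frac{\nabla u}{\sqrt{1+|\nabla u|^2}}\right)=\left(\frac{1}{\sqrt{1+|\nabla u|^2}}\right)^{\alpha}\ \text{ in }\Omega,\qquad u=0\ \text{ on }\partial\Omega .$$ Then $u_{\min}=\min_{\overline\Omega}u$ satisfies $$-u_{\min}\le\frac{1}{\alpha-1}\left(\left(\frac{1}{\cos d}\right)^{\alpha-1}-1\right).$$ -/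

import Mathlib

open scoped ContDiff

noncomputable section

/-- The Euclidean plane. -/
abbrev Plane : Type := EuclideanSpace ℝ (Fin 2)

/-- The boundary of `Ω` is smooth: near each of its points, `Ω` is the negativity set of a
smooth function with nonvanishing differential at that point. -/
def HasSmoothBoundary (Ω : Set Plane) : Prop :=
  ∀ p ∈ frontier Ω, ∃ (U : Set Plane) (ρ : Plane → ℝ),
    IsOpen U ∧ p ∈ U ∧ ContDiffOn ℝ ∞ ρ U ∧ fderiv ℝ ρ p ≠ 0 ∧
      Ω ∩ U = {x ∈ U | ρ x < 0}

/-- Bounded strictly convex planar domains with smooth boundary. Strict convexity is a condition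
on the closure (no boundary segments); for an open set `StrictConvex` alone would only say
`Convex`. It is implied by positivity of the curvature of the boundary. -/
structure IsSmoothStrictlyConvexDomain (Ω : Set Plane) : Prop where
  isOpen : IsOpen Ω
  nonempty : Ω.Nonempty
  isBounded : Bornology.IsBounded Ω
  convex : Convex ℝ Ω
  strictConvex_closure : StrictConvex ℝ (closure Ω)
  smoothBoundary : HasSmoothBoundary Ω

/-- The divergence of a planar vector field. -/
def divergence (F : Plane → Plane) (x : Plane) : ℝ :=
  ∑ i : Fin 2, (fderiv ℝ F x (EuclideanSpace.single i 1)) i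

/-- Classical solutions `u ∈ C²(Ω) ∩ C⁰(closure Ω)` of the Dirichlet problem
`div (∇u / √(1 + |∇u|²)) = (1 / √(1 + |∇u|²)) ^ α` in `Ω`, `u = 0` on `∂Ω`. -/
structure IsClassicalSolution (α : ℝ) (Ω : Set Plane) (u : Plane → ℝ) : Prop where
  contDiffOn : ContDiffOn ℝ 2 u Ω
  continuousOn : ContinuousOn u (closure Ω)
  equation : ∀ x ∈ Ω,
    divergence (fun y => (1 / √(1 + ‖gradient u y‖ ^ 2)) • gradient u y) x
      = (1 / √(1 + ‖gradient u x‖ ^ 2)) ^ α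
  boundary : ∀ x ∈ frontier Ω, u x = 0

/-- The inradius: the supremum of the radii of the balls contained in `Ω`. -/
def inradius (Ω : Set Plane) : ℝ :=
  sSup {r : ℝ | 0 < r ∧ ∃ x : Plane, Metric.ball x r ⊆ Ω}

end

open scoped RealInnerProductSpace Topology
open Filter

/-! Let `δ` be the distance to the complement and `c` slightly above the inradius. The barrier is `G
∘ δ`, with `G = grimReaper c` solving the equation with exponent 1 in one variable. If `u - G ∘ δ`
had an interior minimum, then, `δ` lying below an affine function by convexity and `G` being
decreasing, `G` of that affine function would touch `u` from below
(`Convex.exists_infDist_compl_le`). Comparing curvatures (`mean_curvature_le_of_isLocalMin_sub`)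
gives `cos θ ≤ (cos θ) ^ α` with `0 < cos θ < 1`, impossible for `α > 1`. So the minimum lies on the
boundary, where it is 0, and `u ≥ G ∘ δ ≥ log cos c`. Letting `c` tend to the inradius `d` gives
`-umin ≤ log (1 / cos d)`, which is stronger than the claim. -/

/-- The second-order necessary condition at a local minimum. -/
theorem IsLocalMin.second_deriv_nonneg {g g' : ℝ → ℝ} {a c : ℝ} (hmin : IsLocalMin g a)
    (hg : ∀ᶠ t in 𝓝 a, HasDerivAt g (g' t) t) (hg' : HasDerivAt g' c a) : 0 ≤ c := by
  by_contra! hc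
  have hderiv : deriv g =ᶠ[𝓝 a] g' := hg.mono fun t ht => ht.deriv
  have hdd : deriv (deriv g) a = c := by rw [hderiv.deriv_eq, hg'.deriv]
  -- With `c < 0` the point is also a local maximum, so `g` is locally constant and `c = 0`.
  have hmax : IsLocalMax g a :=
    isLocalMax_of_deriv_deriv_neg (hdd ▸ hc) hmin.deriv_eq_zero hg.self_of_nhds.continuousAt
  have hconst : g =ᶠ[𝓝 a] fun _ => g a := by
    filter_upwards [hmin, hmax] with t h1 h2 using le_antisymm h2 h1
  have h0 : deriv (deriv g) a = 0 := by
    rw [hconst.deriv.deriv_eq]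
    simp
  linarith

theorem ContDiffAt.differentiableAt_gradient {E : Type*} [NormedAddCommGroup E]
    [InnerProductSpace ℝ E] [CompleteSpace E] {u : E → ℝ} {x : E} (hu : ContDiffAt ℝ 2 u x) :
    DifferentiableAt ℝ (gradient u) x := by
  have h1 : DifferentiableAt ℝ (fderiv ℝ u) x :=
    (hu.fderiv_right (m := 1) (by norm_num)).differentiableAt (by norm_num)
  exact (InnerProductSpace.toDual ℝ E).symm.toContinuousLinearEquiv.differentiableAt.comp x h1

theorem ContDiffAt.eventually_hasGradientAt {E : Type*} [NormedAddCommGroup E]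
    [InnerProductSpace ℝ E] [CompleteSpace E] {u : E → ℝ} {x : E} (hu : ContDiffAt ℝ 2 u x) :
    ∀ᶠ y in 𝓝 x, HasGradientAt u (gradient u y) y := by
  filter_upwards [hu.eventually (by simp)] with y hy
  exact (hy.differentiableAt (by norm_num)).hasGradientAt

/-- The derivative of the field `V / √(1 + |V|²)`. -/
theorem HasFDerivAt.inv_sqrt_one_add_norm_sq_smul {E : Type*} [NormedAddCommGroup E]
    [InnerProductSpace ℝ E] {V : E → E} {H : E →L[ℝ] E} {x : E} (hV : HasFDerivAt V H x) :
    ∃ L : E →L[ℝ] E, HasFDerivAt (fun y => (1 / √(1 + ‖V y‖ ^ 2)) • V y) L x ∧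
      ∀ v, L v = (1 / √(1 + ‖V x‖ ^ 2)) • H v
        - ((1 / √(1 + ‖V x‖ ^ 2)) ^ 3 * ⟪V x, H v⟫) • V x := by
  have hq : 0 < 1 + ‖V x‖ ^ 2 := by positivity
  have hs : 0 < √(1 + ‖V x‖ ^ 2) := Real.sqrt_pos.2 hq
  have h1 := (hV.norm_sq.const_add 1).sqrt hq.ne'
  have h2 := ((hasDerivAt_inv hs.ne').comp_hasFDerivAt x h1).smul hV
  refine ⟨_, by simp only [one_div]; exact h2, fun v => ?_⟩
  simp only [Function.comp_def, one_div, add_apply, smul_apply,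
    ContinuousLinearMap.smulRight_apply, ContinuousLinearMap.comp_apply, innerSL_apply_apply,
    smul_eq_mul, sub_eq_add_neg, ← neg_smul]
  congr 2
  field_simp
  rw [two_nsmul, two_mul]

/-- The trace of a planar linear map, in the orthonormal frame given by a unit vector and its
rotation. -/
theorem sum_apply_single_eq_inner_add_inner (L : Plane →L[ℝ] Plane) {e : Plane} (he : ‖e‖ = 1) :
    ∑ i : Fin 2, (L (EuclideanSpace.single i 1)) i
      = ⟪e, L e⟫ + ⟪(!₂[-e 1, e 0] : Plane), L !₂[-e 1, e 0]⟫ := by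
  have hsq : e 0 ^ 2 + e 1 ^ 2 = 1 := by
    have := EuclideanSpace.real_norm_sq_eq e
    rw [he, Fin.sum_univ_two] at this
    linarith
  have key : ∀ v : Plane, L v = v 0 • L (EuclideanSpace.single 0 1)
      + v 1 • L (EuclideanSpace.single 1 1) := by
    intro v
    rw [← map_smul, ← map_smul, ← map_add]
    congr 1
    ext i
    fin_cases i <;> simp
  rw [key e, key !₂[-e 1, e 0]]
  simp only [Fin.sum_univ_two, PiLp.inner_apply, RCLike.inner_apply, conj_trivial,
    PiLp.add_apply, PiLp.smul_apply, smul_eq_mul, Matrix.cons_val_zero,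
    Matrix.cons_val_one]
  linear_combination (-(L (EuclideanSpace.single 0 1)) 0 - (L (EuclideanSpace.single 1 1)) 1) * hsq

/-- If a function of one variable touches `u` from below at `x` then its mean curvature at `x`
does not exceed that of `u`. -/
theorem mean_curvature_le_of_isLocalMin_sub {u : Plane → ℝ} {x e : Plane}
    (hu : ContDiffAt ℝ 2 u x) (he : ‖e‖ = 1) {G G' : ℝ → ℝ} {s c : ℝ}
    (hG : ∀ᶠ t in 𝓝 s, HasDerivAt G (G' t) t) (hG' : HasDerivAt G' c s)
    (hmin : IsLocalMin (fun y => u y - G (s + ⟪e, y - x⟫)) x) :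
    gradient u x = G' s • e ∧
      c * (1 / √(1 + G' s ^ 2)) ^ 3 ≤
        divergence (fun y => (1 / √(1 + ‖gradient u y‖ ^ 2)) • gradient u y) x := by
  set V := gradient u with hV
  obtain ⟨H, hH⟩ := hu.differentiableAt_gradient
  have hgrad := hu.eventually_hasGradientAt
  have line : ∀ v : Plane, ∀ t : ℝ, HasDerivAt (fun t : ℝ => x + t • v) v t := fun v t => by
    simpa using ((hasDerivAt_id t).smul_const v).const_add x
  have line0 : ∀ v : Plane, Tendsto (fun t : ℝ => x + t • v) (𝓝 0) (𝓝 x) := fun v => by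
    simpa using (line v 0).continuousAt.tendsto
  have param : ∀ v : Plane, ∀ t : ℝ, HasDerivAt (fun t : ℝ => s + t * ⟪e, v⟫) ⟪e, v⟫ t :=
    fun v t => by simpa using ((hasDerivAt_id t).mul_const ⟪e, v⟫).const_add s
  have param0 : ∀ v : Plane, Tendsto (fun t : ℝ => s + t * ⟪e, v⟫) (𝓝 0) (𝓝 s) := fun v => by
    simpa using (param v 0).continuousAt.tendsto
  have hmin' : ∀ v : Plane,
      IsLocalMin (fun t : ℝ => u (x + t • v) - G (s + t * ⟪e, v⟫)) 0 := fun v => by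
    filter_upwards [(line0 v).eventually hmin] with t ht
    simpa [inner_smul_right] using ht
  have hd1 : ∀ v : Plane, ∀ᶠ t in 𝓝 (0 : ℝ),
      HasDerivAt (fun t : ℝ => u (x + t • v) - G (s + t * ⟪e, v⟫))
        (⟪V (x + t • v), v⟫ - G' (s + t * ⟪e, v⟫) * ⟪e, v⟫) t := fun v => by
    filter_upwards [(line0 v).eventually hgrad, (param0 v).eventually hG] with t h1 h2
    exact (h1.hasFDerivAt.comp_hasDerivAt t (line v t)).sub (h2.comp t (param v t))
  have hfirst : ∀ v : Plane, ⟪V x, v⟫ = G' s * ⟪e, v⟫ := fun v => by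
    have := (hmin' v).hasDerivAt_eq_zero (hd1 v).self_of_nhds
    simp only [zero_smul, zero_mul, add_zero] at this
    linarith
  have hVx : V x = G' s • e := by
    refine ext_inner_right ℝ fun v => ?_
    rw [hfirst, inner_smul_left, conj_trivial]
  have hsecond : ∀ v : Plane, c * ⟪e, v⟫ ^ 2 ≤ ⟪v, H v⟫ := fun v => by
    have hHv : HasDerivAt (fun t : ℝ => V (x + t • v)) (H v) 0 := by
      have hH' : HasFDerivAt V H (x + (0 : ℝ) • v) := by simpa using hH
      exact hH'.comp_hasDerivAt 0 (line v 0)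
    have hGv : HasDerivAt (fun t : ℝ => G' (s + t * ⟪e, v⟫)) (c * ⟪e, v⟫) 0 := by
      have hG'' : HasDerivAt G' c (s + 0 * ⟪e, v⟫) := by simpa using hG'
      exact hG''.comp 0 (param v 0)
    have h2 := (hHv.inner ℝ (hasDerivAt_const (0 : ℝ) v)).sub (hGv.mul_const ⟪e, v⟫)
    have := (hmin' v).second_deriv_nonneg (hd1 v) h2
    rw [inner_zero_right, zero_add, real_inner_comm] at this
    linarith
  refine ⟨hVx, ?_⟩
  obtain ⟨L, hL, hLv⟩ := hH.inv_sqrt_one_add_norm_sq_smul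
  have hnorm : ‖V x‖ ^ 2 = G' s ^ 2 := by rw [hVx, norm_smul, he, mul_one, Real.norm_eq_abs, sq_abs]
  have hee : ⟪e, e⟫ = (1 : ℝ) := by rw [real_inner_self_eq_norm_sq, he, one_pow]
  have hperp : ⟪e, (!₂[-e 1, e 0] : Plane)⟫ = (0 : ℝ) := by
    simp [PiLp.inner_apply, Fin.sum_univ_two]
    ring
  unfold divergence
  rw [hL.fderiv, sum_apply_single_eq_inner_add_inner L he, hLv, hLv, ← hV, hnorm, hVx]
  set f : Plane := !₂[-e 1, e 0] with hf
  have hfe : ⟪f, e⟫ = (0 : ℝ) := by rw [real_inner_comm, hperp]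
  simp only [inner_sub_right, inner_smul_right, inner_smul_left, conj_trivial, hee, hfe]
  have h1 := hsecond e
  have h2 := hsecond f
  rw [hee] at h1
  rw [hperp] at h2
  have hq : 0 < 1 + G' s ^ 2 := by positivity
  set k := 1 / √(1 + G' s ^ 2) with hk
  have hk0 : 0 < k := by positivity
  have hk2 : k ^ 2 * (1 + G' s ^ 2) = 1 := by
    rw [hk, div_pow, Real.sq_sqrt hq.le]
    field_simp
  -- The direction `e` contributes `k ^ 3 * ⟪e, H e⟫` to the trace; the direction `f`, along which
  -- the barrier is constant, contributes a nonnegative term.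
  have h3 : c * k ^ 3 ≤ ⟪e, H e⟫ * k ^ 3 := by
    have : 0 < k ^ 3 := by positivity
    nlinarith
  have h4 : 0 ≤ k * ⟪f, H f⟫ := mul_nonneg hk0.le (by linarith)
  have h5 : k * ⟪e, H e⟫ - k ^ 3 * (G' s * ⟪e, H e⟫) * (G' s * 1) = ⟪e, H e⟫ * k ^ 3 := by
    linear_combination (-k * ⟪e, H e⟫) * hk2
  linarith

/-! ### Distance to the complement and inradius -/

/-- In a convex open set, the distance to the complement is touched from above, at each point, by
an affine function with unit gradient. -/
theorem Convex.exists_infDist_compl_le {E : Type*} [NormedAddCommGroup E]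
    [InnerProductSpace ℝ E] [FiniteDimensional ℝ E] {Ω : Set E} (hc : Convex ℝ Ω)
    (ho : IsOpen Ω) (hne : Ωᶜ.Nonempty) {x : E} (hx : x ∈ Ω) :
    ∃ e : E, ‖e‖ = 1 ∧ ∀ y ∈ Ω,
      Metric.infDist y Ωᶜ ≤ Metric.infDist x Ωᶜ + ⟪e, y - x⟫ := by
  have : CompleteSpace E := FiniteDimensional.complete ℝ E
  have : ProperSpace E := FiniteDimensional.proper_real E
  obtain ⟨p, hp, hpd⟩ := ho.isClosed_compl.exists_infDist_eq_dist hne x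
  obtain ⟨f, hf⟩ := geometric_hahn_banach_open_point hc ho hp
  set n : E := (InnerProductSpace.toDual ℝ E).symm f with hn
  have hfn : ∀ y, f y = ⟪n, y⟫ := fun y => by rw [hn, InnerProductSpace.toDual_symm_apply]
  have hn0 : n ≠ 0 := by
    intro h
    have := hf x hx
    simp [hfn, h] at this
  have hnn : ‖n‖ ≠ 0 := norm_ne_zero_iff.2 hn0
  set e : E := -(‖n‖⁻¹ • n) with hedef
  have he : ‖e‖ = 1 := by
    rw [hedef, norm_neg, norm_smul, norm_inv, norm_norm, inv_mul_cancel₀ hnn]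
  have hpos : ∀ y ∈ Ω, 0 < ⟪e, y - p⟫ := by
    intro y hy
    have h := hf y hy
    rw [hfn, hfn] at h
    rw [hedef, inner_neg_left, inner_smul_left, inner_sub_right, conj_trivial, ← mul_neg, neg_sub]
    exact mul_pos (by positivity) (by linarith)
  have hle : ∀ y ∈ Ω, Metric.infDist y Ωᶜ ≤ ⟪e, y - p⟫ := by
    intro y hy
    -- The orthogonal projection of `y` onto the supporting hyperplane at the nearest point `p` lies
    -- outside `Ω`.
    have hout : y - ⟪e, y - p⟫ • e ∈ Ωᶜ := by
      intro hmem
      have := hpos _ hmem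
      rw [sub_right_comm, inner_sub_right, inner_smul_right, real_inner_self_eq_norm_sq, he] at this
      linarith
    refine (Metric.infDist_le_dist_of_mem hout).trans_eq ?_
    rw [dist_eq_norm, sub_sub_cancel, norm_smul, he, mul_one, Real.norm_eq_abs,
      abs_of_pos (hpos y hy)]
  refine ⟨e, he, fun y hy => (hle y hy).trans ?_⟩
  have h1 : ⟪e, x - p⟫ ≤ Metric.infDist x Ωᶜ := by
    rw [hpd, dist_eq_norm]
    simpa [he] using real_inner_le_norm e (x - p)
  have h2 : ⟪e, y - p⟫ = ⟪e, x - p⟫ + ⟪e, y - x⟫ := by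
    rw [← inner_add_right]
    congr 1
    abel
  linarith

/-- A bounded planar set has bounded radii of balls contained in it. -/
theorem bddAbove_radii {Ω : Set Plane} (hb : Bornology.IsBounded Ω) :
    BddAbove {r : ℝ | 0 < r ∧ ∃ x : Plane, Metric.ball x r ⊆ Ω} := by
  refine ⟨Metric.diam Ω, ?_⟩
  rintro r ⟨hr, x, hx⟩
  have h1 := Metric.diam_mono hx hb
  rw [Metric.diam_ball_eq x hr.le] at h1
  linarith

theorem infDist_compl_le_inradius {Ω : Set Plane} (ho : IsOpen Ω)
    (hb : Bornology.IsBounded Ω) (hne : Ωᶜ.Nonempty) {x : Plane} (hx : x ∈ Ω) :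
    Metric.infDist x Ωᶜ ≤ inradius Ω := by
  refine le_csSup (bddAbove_radii hb) ⟨?_, x, ?_⟩
  · exact (ho.isClosed_compl.notMem_iff_infDist_pos hne).1 (by simpa using hx)
  · exact Metric.ball_infDist_compl_subset

/-! ### The one-dimensional barrier -/

/-- The profile of the barrier, the grim reaper curve with slope `-tan c` at `0`. -/
noncomputable def grimReaper (c t : ℝ) : ℝ := Real.log (Real.cos c) - Real.log (Real.cos (c - t))

theorem hasDerivAt_grimReaper {c t : ℝ} (h : 0 < Real.cos (c - t)) :
    HasDerivAt (grimReaper c) (-Real.tan (c - t)) t := by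
  have h1 : HasDerivAt (fun t => c - t) (-1) t := by simpa using (hasDerivAt_id t).const_sub c
  have h2 := ((h1.cos).log h.ne').const_sub (Real.log (Real.cos c))
  refine h2.congr_deriv ?_
  rw [Real.tan_eq_sin_div_cos]
  ring

/-- With slope `-tan (c - t)`, this second derivative is `1 + tan²`, so the curvature of the profile
is `cos (c - t)`. -/
theorem hasDerivAt_neg_tan_sub {c t : ℝ} (h : 0 < Real.cos (c - t)) :
    HasDerivAt (fun t => -Real.tan (c - t)) (1 / Real.cos (c - t) ^ 2) t := by
  have h1 : HasDerivAt (fun t => c - t) (-1) t := by simpa using (hasDerivAt_id t).const_sub c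
  refine ((Real.hasDerivAt_tan h.ne').comp t h1).neg.congr_deriv ?_
  ring

theorem grimReaper_zero (c : ℝ) : grimReaper c 0 = 0 := by simp [grimReaper]

theorem antitoneOn_grimReaper {c : ℝ} (hc : c < Real.pi / 2) :
    AntitoneOn (grimReaper c) (Set.Icc 0 c) := by
  intro s hs t ht hst
  have hpi := Real.pi_pos
  refine sub_le_sub_left (Real.log_le_log (Real.cos_pos_of_mem_Ioo ⟨?_, ?_⟩)
    (Real.cos_le_cos_of_nonneg_of_le_pi ?_ ?_ ?_)) _ <;> linarith [hs.1, hs.2, ht.1, ht.2]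

theorem log_cos_le_grimReaper {c t : ℝ} (h : 0 < Real.cos (c - t)) :
    Real.log (Real.cos c) ≤ grimReaper c t := by
  have := Real.log_nonpos h.le (Real.cos_le_one _)
  unfold grimReaper
  linarith

/-! ### Comparison and conclusion -/

/-- The comparison with the barrier built on the distance to the boundary. -/
theorem IsClassicalSolution.log_cos_le {α c : ℝ} (hα : 1 < α) {Ω : Set Plane}
    (hΩ : IsSmoothStrictlyConvexDomain Ω) (hdc : inradius Ω < c) (hc : c < Real.pi / 2)
    {u : Plane → ℝ} (hu : IsClassicalSolution α Ω u) {z : Plane} (hz : z ∈ closure Ω) :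
    Real.log (Real.cos c) ≤ u z := by
  have hne : Ωᶜ.Nonempty := by
    rw [Set.nonempty_compl]
    rintro rfl
    exact NormedSpace.unbounded_univ ℝ Plane hΩ.isBounded
  have hpi := Real.pi_pos
  have hzero : ∀ y ∉ Ω, Metric.infDist y Ωᶜ = 0 := fun y hy => Metric.infDist_zero_of_mem hy
  obtain ⟨x₁, hx₁⟩ := hΩ.nonempty
  have hc0 : 0 < c := (Metric.infDist_nonneg.trans
    (infDist_compl_le_inradius hΩ.isOpen hΩ.isBounded hne hx₁)).trans_lt hdc
  have hrange : ∀ y, Metric.infDist y Ωᶜ ∈ Set.Ico 0 c := fun y => by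
    refine ⟨Metric.infDist_nonneg, ?_⟩
    by_cases hy : y ∈ Ω
    · exact (infDist_compl_le_inradius hΩ.isOpen hΩ.isBounded hne hy).trans_lt hdc
    · rwa [hzero y hy]
  have hcos : ∀ t ∈ Set.Ico 0 c, 0 < Real.cos (c - t) := fun t ht =>
    Real.cos_pos_of_mem_Ioo ⟨by linarith [ht.2], by linarith [ht.1]⟩
  have hcont : ContinuousOn (fun y => u y - grimReaper c (Metric.infDist y Ωᶜ)) (closure Ω) := by
    refine hu.continuousOn.sub (Continuous.continuousOn ?_)
    refine continuous_iff_continuousAt.2 fun y => ?_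
    have hcomp := (hasDerivAt_grimReaper (hcos _ (hrange y))).continuousAt
    exact hcomp.comp (f := fun y => Metric.infDist y Ωᶜ)
      (Metric.continuous_infDist_pt Ωᶜ).continuousAt
  obtain ⟨x, hxc, hxmin⟩ := hΩ.isBounded.isCompact_closure.exists_isMinOn ⟨z, hz⟩ hcont
  have hxΩ : x ∉ Ω := by
    intro hx
    obtain ⟨e, he, hle⟩ := hΩ.convex.exists_infDist_compl_le hΩ.isOpen hne hx
    set s := Metric.infDist x Ωᶜ with hs
    have hsr := hrange x
    have hcs := hcos s hsr
    have hloc : IsLocalMin (fun y => u y - grimReaper c (s + ⟪e, y - x⟫)) x := by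
      have hlt : ∀ᶠ y in 𝓝 x, s + ⟪e, y - x⟫ < c := by
        have : ContinuousAt (fun y => s + ⟪e, y - x⟫) x := by fun_prop
        exact this.eventually_lt_const (by simpa using hsr.2)
      filter_upwards [hΩ.isOpen.mem_nhds hx, hlt] with y hy hyc
      have h1 := hxmin (subset_closure hy)
      have h2 := antitoneOn_grimReaper hc ⟨(hrange y).1, (hrange y).2.le⟩
        ⟨(hrange y).1.trans (hle y hy), hyc.le⟩ (hle y hy)
      simp only [Set.mem_ofPred_eq, sub_self, inner_zero_right, add_zero] at h1 ⊢
      linarith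
    have hder : ∀ᶠ t in 𝓝 s, HasDerivAt (grimReaper c) (-Real.tan (c - t)) t := by
      have : ContinuousAt (fun t => Real.cos (c - t)) s := by fun_prop
      filter_upwards [this.eventually_const_lt hcs] with t ht using hasDerivAt_grimReaper ht
    obtain ⟨hgrad, hcurv⟩ := mean_curvature_le_of_isLocalMin_sub
      (hu.contDiffOn.contDiffAt (hΩ.isOpen.mem_nhds hx)) he hder (hasDerivAt_neg_tan_sub hcs) hloc
    have hk : 1 / √(1 + (-Real.tan (c - s)) ^ 2) = Real.cos (c - s) := by
      rw [neg_sq, one_div, Real.inv_sqrt_one_add_tan_sq hcs]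
    have hnorm : ‖gradient u x‖ ^ 2 = (-Real.tan (c - s)) ^ 2 := by
      rw [hgrad, norm_smul, he, mul_one, Real.norm_eq_abs, sq_abs]
    rw [hu.equation x hx, hnorm, hk] at hcurv
    -- Strict because `s ≤ inradius Ω < c`; this is why `c` exceeds the inradius.
    have hlt1 : Real.cos (c - s) < 1 := by
      rw [← Real.cos_zero]
      exact Real.cos_lt_cos_of_nonneg_of_le_pi_div_two le_rfl (by linarith [hsr.1])
        (by linarith [hsr.2])
    have hlt2 := Real.rpow_lt_rpow_of_exponent_gt hcs hlt1 hα
    rw [Real.rpow_one] at hlt2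
    have : 1 / Real.cos (c - s) ^ 2 * Real.cos (c - s) ^ 3 = Real.cos (c - s) := by
      field_simp
    linarith
  have hxu : u x = 0 := hu.boundary x (by
    rw [frontier, hΩ.isOpen.interior_eq]
    exact ⟨hxc, hxΩ⟩)
  have h1 := hxmin hz
  simp only [Set.mem_ofPred_eq, hxu, hzero x hxΩ, grimReaper_zero, sub_zero] at h1
  linarith [log_cos_le_grimReaper (hcos _ (hrange z))]

/-- This is `log y ≤ y - 1` at `y = x ^ p`; it weakens the logarithmic bound to the stated power
bound. -/
theorem Real.log_le_rpow_sub_one_div {x p : ℝ} (hx : 0 < x) (hp : 0 < p) :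
    Real.log x ≤ 1 / p * (x ^ p - 1) := by
  have h := Real.log_le_sub_one_of_pos (Real.rpow_pos_of_pos hx p)
  rw [Real.log_rpow hx] at h
  rw [one_div, ← div_eq_inv_mul, le_div_iff₀ hp]
  linarith

theorem theorem6p1 (α : ℝ) (hα : 1 < α) (Ω : Set Plane)
    (hΩ : IsSmoothStrictlyConvexDomain Ω) (hd : inradius Ω < Real.pi / 2)
    (u : Plane → ℝ) (hu : IsClassicalSolution α Ω u) :
    ∃ umin : ℝ, IsLeast (u '' closure Ω) umin ∧
      -umin ≤ 1 / (α - 1) * ((1 / Real.cos (inradius Ω)) ^ (α - 1) - 1) := by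
  obtain ⟨z, hz, hzmin⟩ := hΩ.isBounded.isCompact_closure.exists_isMinOn
    hΩ.nonempty.closure hu.continuousOn
  refine ⟨u z, ⟨⟨z, hz, rfl⟩, by rintro _ ⟨y, hy, rfl⟩; exact hzmin hy⟩, ?_⟩
  have hnonneg : 0 ≤ inradius Ω := Real.sSup_nonneg fun r hr => hr.1.le
  have hcos : 0 < Real.cos (inradius Ω) :=
    Real.cos_pos_of_mem_Ioo ⟨by linarith [Real.pi_pos], hd⟩
  have hlim : Tendsto (fun c => Real.log (Real.cos c)) (𝓝[>] (inradius Ω))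
      (𝓝 (Real.log (Real.cos (inradius Ω)))) :=
    (Real.continuous_cos.continuousAt.log hcos.ne').tendsto.mono_left nhdsWithin_le_nhds
  have hlog : Real.log (Real.cos (inradius Ω)) ≤ u z := by
    -- The barrier needs `c` strictly above the inradius, so the bound there is reached as a limit
    -- from the right.
    refine le_of_tendsto hlim ?_
    filter_upwards [Ioo_mem_nhdsGT hd] with c hc
    exact hu.log_cos_le hα hΩ hc.1 hc.2 hz
  have h := Real.log_le_rpow_sub_one_div (one_div_pos.2 hcos) (sub_pos.2 hα)
  rw [one_div, Real.log_inv, ← one_div] at h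
  linarith
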